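/- Let $1<q<p$ be real numbers. Let $\mathcal R$ be the Riemann surface of the logarithm, and let $[n]_{p,q}^!=\prod_{j=1}^n\frac{p^j-q^j}{p-q}$, $m_{p,q}=([n]^!_{p,q})_{n\ge 0}$. For $a>1$ put $$[n]_a^!=\prod_{j=1}^n\frac{a^j-1}{a-1},\qquad \exp_a(z)=\sum_{n\ge0}\frac{z^n}{[n]_a^!},\qquad \Theta_q(z)=\sum_{n\in\mathbb Z}\frac{z^n}{q^{n(n-1)/2}},$$ $$\tilde e_1(z)=\frac{p/q-1}{\log p-\log q}\,\frac{z}{\exp_{p/q}(pz/q)},\qquad \tilde e_2(z)=\frac{q}{\log q}\,\frac{z}{\Theta_q(qz)} .$$ For a sequence $M=(M_n)_{n\ge0}$ of positive reals let $\omega_M(t)=\sup_{n\ge0}\log(t^n/M_n)$ for $t>0$ and $\omega_M(0)=0$. For an unbounded sector $S\subset\mathcal R$ with vertex at the origin and $k>0$, let $\mathcal O^{M,k}(S)$ be the set of holomorphic functions $f$ on $S$, continuous at the origin, such that for every proper unbounded subsector $T$ of $S$ there is $c>0$ with $|f(z)|\le c\,e^{\omega_M(|z|/k)}$ for all $z\in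 T$. **Proposition.** Let $f\in\mathcal O^{m_{p,q},k}(S)$ for some unbounded sector $S\subset\mathcal R$ and some $k>1$, and let $z\in\mathcal R$ with $|z|<\min\{p/q-1,\,k\}$. Then there exist a neighborhood $U\subset\mathcal R$ of $z$ and real numbers $\theta,\phi$, with the ray of direction $\theta$ contained in $S$, such that for every $z'\in U$ the double integral $$\int_0^{\infty(\theta+\phi)}\int_0^{\infty(\theta)}\tilde e_1(v/z')\,\tilde e_2(u/v)\,f(u)\,\frac{du}{u}\,\frac{dv}{v}$$ converges absolutely, i.e. $$\int_0^\infty\!\!\int_0^\infty\bigl|\tilde e_1(v/z')\,\tilde e_2(u/v)\,f(u)\bigr|\,\frac{dr}{r}\,\frac{ds}{s}<\infty,\qquad u=re^{i\theta},\ v=se^{i(\theta+\phi)} .$$ -/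

import Mathlib

open Set Filter Topology MeasureTheory
open scoped ENNReal

noncomputable section

/-- The Riemann surface of the logarithm, in polar coordinates: pairs `(r, t)` of a modulus
`r > 0` and an argument `t : ℝ` (arguments are not taken modulo `2π`). -/
abbrev LogSurface : Type := {x : ℝ × ℝ // 0 < x.1}

namespace LogSurface

/-- The modulus `|z|`. -/
def modulus (z : LogSurface) : ℝ := z.1.1

/-- The argument of `z`. -/
def arg (z : LogSurface) : ℝ := z.1.2

/-- The covering projection onto `ℂ \ {0}`. -/
def toComplex (z : LogSurface) : ℂ := (z.modulus : ℂ) * Complex.exp ((z.arg : ℂ) * Complex.I)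

/-- The global holomorphic chart: the point `e ^ w` of the surface, with modulus `e ^ (re w)` and
argument `im w`. -/
def ofLog (w : ℂ) : LogSurface := ⟨(Real.exp w.re, w.im), Real.exp_pos _⟩

open Classical in
/-- The point of modulus `r` on the ray of argument `t`, for `r > 0`
(for `r ≤ 0`, where it is never used, an arbitrary point). -/
def ray (t r : ℝ) : LogSurface :=
  if h : 0 < r then ⟨(r, t), h⟩ else ⟨(1, t), one_pos⟩

/-- The unbounded open sector with vertex at the origin, bisecting direction `d` and
opening `α`. -/
def sector (d α : ℝ) : Set LogSurface := {z | |z.arg - d| < α / 2}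

/-- `f` is holomorphic on the subset `S` of the surface. -/
def HolomorphicOn (f : LogSurface → ℂ) (S : Set LogSurface) : Prop :=
  DifferentiableOn ℂ (fun w => f (ofLog w)) (ofLog ⁻¹' S)

end LogSurface

/-- The `(p,q)`-factorial `∏_{j=1}^n (p^j - q^j) / (p - q)`. -/
def pqFactorial (p q : ℝ) (n : ℕ) : ℝ :=
  ∏ j ∈ Finset.Icc 1 n, (p ^ j - q ^ j) / (p - q)

/-- The `q`-factorial `∏_{j=1}^n (q^j - 1) / (q - 1)`. -/
def qFactorial (q : ℝ) (n : ℕ) : ℝ :=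
  ∏ j ∈ Finset.Icc 1 n, (q ^ j - 1) / (q - 1)

/-- The `q`-exponential function `∑_{n ≥ 0} z^n / [n]_q!`. -/
def qExp (q : ℝ) (z : ℂ) : ℂ := ∑' n : ℕ, z ^ n / (qFactorial q n : ℂ)

/-- The Jacobi Theta function `∑_{n ∈ ℤ} z^n / q^(n(n-1)/2)`; the integer division is exact. -/
def jacobiThetaQ (q : ℝ) (z : ℂ) : ℂ :=
  ∑' n : ℤ, z ^ n / (q : ℂ) ^ (n * (n - 1) / 2)

/-- The kernel `e₁`, whose moments are the `p/q`-factorials. -/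
def kernelOne (p q : ℝ) (z : ℂ) : ℂ :=
  (((p / q - 1) / (Real.log p - Real.log q) : ℝ) : ℂ) * (1 / qExp (p / q) ((p : ℂ) * z / (q : ℂ)))

/-- The kernel `e₂`, whose moments are `q^(n(n-1)/2)`. -/
def kernelTwo (q : ℝ) (z : ℂ) : ℂ :=
  ((q / Real.log q : ℝ) : ℂ) * (1 / jacobiThetaQ q ((q : ℂ) * z))

/-- `ẽ₁(z) = z e₁(z)`. -/
def kernelOneTilde (p q : ℝ) (z : ℂ) : ℂ := z * kernelOne p q z

/-- `ẽ₂(z) = z e₂(z)`. -/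
def kernelTwoTilde (q : ℝ) (z : ℂ) : ℂ := z * kernelTwo q z

open Classical in
/-- The function `ω_M(t) = sup_{n ≥ 0} log (t^n / M_n)` for `t > 0`, and `ω_M(0) = 0`. -/
def weightOmega (M : ℕ → ℝ) (t : ℝ) : ℝ :=
  if t = 0 then 0 else ⨆ n : ℕ, Real.log (t ^ n / M n)

/-- The class `O^{M,k}(S)` for the unbounded sector `S` of bisecting direction `d` and opening `α`:
functions holomorphic on `S`, continuous at the origin (they have a finite limit as `z → 0` in `S`),
with `|f(z)| ≤ c exp (ω_M(|z| / k))` on every proper unbounded subsector `T` of `S`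
(that is, a sector whose closure in the surface is contained in `S`), where `c` may depend
on `T`. -/
structure MemGrowthClass (M : ℕ → ℝ) (k d α : ℝ) (f : LogSurface → ℂ) : Prop where
  holomorphic : LogSurface.HolomorphicOn f (LogSurface.sector d α)
  continuous_zero : ∃ l : ℂ,
    Tendsto f (comap LogSurface.modulus (𝓝 0) ⊓ 𝓟 (LogSurface.sector d α)) (𝓝 l)
  growth : ∀ d' β : ℝ, 0 < β →
    closure (LogSurface.sector d' β) ⊆ LogSurface.sector d α →
    ∃ c : ℝ, 0 < c ∧ ∀ z ∈ LogSurface.sector d' β,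
      ‖f z‖ ≤ c * Real.exp (weightOmega M (z.modulus / k))

/-- The integrand `ẽ₁(v/z) ẽ₂(u/v) f(u) (1/r) (1/s)` with `u` of modulus `r` and argument `θ`, and
`v` of modulus `s` and argument `θ + φ`; along these rays `du/u = dr/r` and `dv/v = ds/s`. -/
def convIntegrand (p q : ℝ) (f : LogSurface → ℂ) (z : LogSurface) (θ φ : ℝ)
    (s r : ℝ) : ℂ :=
  let u := LogSurface.ray θ r
  let v := LogSurface.ray (θ + φ) s
  kernelOneTilde p q (v.toComplex / z.toComplex) * kernelTwoTilde q (u.toComplex / v.toComplex)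
    * f u * ((1 / r : ℝ) : ℂ) * ((1 / s : ℝ) : ℂ)

end

/-! Take `φ = 0`. Then `u / v = r / s` is positive, so the Theta function is only evaluated where
its series has positive terms. Write `a = p / q` and `ζ = e^{iθ} / z'`; the direction `θ` is chosen
so that `ζ` avoids the negative real axis, which carries the zeros of `exp_a`.

Inner integral: `exp (ω_M (r / k))` is a supremum of the terms `(r / k)^n / m_n`, hence at most
their sum. After `r = s x`, integrating term by term leaves the moments of `1 / Θ_q (q x)`, which
equal `q^(n(n-1)/2)` up to one constant. Since `m_n = q^(n(n-1)/2) [n]_a!`, what remains is `C exp_a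
(s / k)` (`exists_lintegral_weightOmega_div_jacobiThetaQ_le`).

Outer integral: it remains to integrate `h(s) = exp_a (s / k) / |exp_a (a s ζ)|`. The equation
`exp_a (a w) = (1 + (a - 1) w) exp_a w` shows that `a h(a s) / h(s)` tends to `1 / (k |ζ|) = |z'| /
k < 1`, so `h` is integrable (`integrableOn_qExp_div_qExp`). The conditions on `z'` are open, so one
`θ` serves a whole neighborhood. -/

/-! ### Factorials. -/

theorem qFactorial_succ (a : ℝ) (n : ℕ) :
    qFactorial a (n + 1) = qFactorial a n * ((a ^ (n + 1) - 1) / (a - 1)) := by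
  unfold qFactorial
  rw [Finset.prod_Icc_succ_top (by omega)]

theorem qFactorial_pos {a : ℝ} (ha : 1 < a) (n : ℕ) : 0 < qFactorial a n := by
  refine Finset.prod_pos fun j hj => ?_
  have hj : j ≠ 0 := by have := (Finset.mem_Icc.mp hj).1; omega
  have h : 1 < a ^ j := one_lt_pow₀ ha hj
  exact div_pos (by linarith) (by linarith)

/-- The ratio of consecutive `(p,q)`-factorials is `q ^ n` times that of the `p/q`-factorials. -/
theorem pqFactorial_succ_div {p q : ℝ} (hq : 1 < q) (hpq : q < p) (n : ℕ) :
    pqFactorial p q (n + 1) / qFactorial (p / q) (n + 1)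
      = q ^ n * (pqFactorial p q n / qFactorial (p / q) n) := by
  have hq0 : 0 < q := by linarith
  have ha : 1 < p / q := (one_lt_div hq0).mpr hpq
  have hF := (qFactorial_pos ha n).ne'
  have h1 : (p / q) ^ (n + 1) - 1 ≠ 0 := by
    have := one_lt_pow₀ ha (Nat.succ_ne_zero n)
    exact ne_of_gt (by simpa using this)
  have h2 : p / q - 1 ≠ 0 := by linarith
  have h3 : p - q ≠ 0 := by linarith
  have key : (p ^ (n + 1) - q ^ (n + 1)) / (p - q)
      = q ^ n * (((p / q) ^ (n + 1) - 1) / (p / q - 1)) := by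
    rw [div_pow, div_sub_one hq0.ne', div_sub_one (pow_ne_zero _ hq0.ne')]
    field_simp
    ring
  have hs : pqFactorial p q (n + 1)
      = pqFactorial p q n * ((p ^ (n + 1) - q ^ (n + 1)) / (p - q)) := by
    unfold pqFactorial
    rw [Finset.prod_Icc_succ_top (by omega)]
  rw [hs, qFactorial_succ, key]
  field_simp

theorem pqFactorial_pos {p q : ℝ} (hq : 1 < q) (hpq : q < p) (n : ℕ) : 0 < pqFactorial p q n := by
  refine Finset.prod_pos fun j hj => ?_
  have hj : j ≠ 0 := by have := (Finset.mem_Icc.mp hj).1; omega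
  have h : q ^ j < p ^ j := pow_lt_pow_left₀ hpq (by linarith) hj
  exact div_pos (by linarith) (by linarith)

/-- The quotient is `q^(n(n-1)/2)`. The comparison makes `∑ x^n / m_n` converge for every `x ≥ 0`.
-/
theorem qFactorial_le_pqFactorial {p q : ℝ} (hq : 1 < q) (hpq : q < p) (n : ℕ) :
    qFactorial (p / q) n ≤ pqFactorial p q n := by
  have ha : 1 < p / q := (one_lt_div (by linarith)).mpr hpq
  rw [← one_le_div (qFactorial_pos ha n)]
  induction n with
  | zero => simp [pqFactorial, qFactorial]
  | succ n ih =>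
    rw [pqFactorial_succ_div hq hpq]
    exact one_le_mul_of_one_le_of_one_le (one_le_pow₀ hq.le) ih

/-! ### The `q`-exponential: functional equation and zeros. -/

theorem summable_pow_div_qFactorial {a : ℝ} (ha : 1 < a) {x : ℝ} (hx : 0 ≤ x) :
    Summable fun n : ℕ => x ^ n / qFactorial a n := by
  rcases hx.eq_or_lt with rfl | hx
  · refine summable_of_ne_finset_zero (s := {0}) fun n hn => ?_
    rw [zero_pow (by simpa using hn), zero_div]
  refine summable_of_ratio_test_tendsto_lt_one zero_lt_one
    (Eventually.of_forall fun n => (div_pos (pow_pos hx n) (qFactorial_pos ha n)).ne') ?_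
  have h1 : Tendsto (fun n : ℕ => a ^ (n + 1) - 1) atTop atTop :=
    tendsto_atTop_add_const_right _ _
      ((tendsto_add_atTop_iff_nat 1).mpr (tendsto_pow_atTop_atTop_of_one_lt ha))
  refine (h1.const_div_atTop (x * (a - 1))).congr fun n => ?_
  rw [Real.norm_of_nonneg (div_pos (pow_pos hx _) (qFactorial_pos ha _)).le,
    Real.norm_of_nonneg (div_pos (pow_pos hx _) (qFactorial_pos ha _)).le, qFactorial_succ]
  have hF := (qFactorial_pos ha n).ne'
  have h2 : a ^ (n + 1) - 1 ≠ 0 := by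
    have := one_lt_pow₀ ha (Nat.succ_ne_zero n)
    exact ne_of_gt (by simpa using this)
  have h3 : a - 1 ≠ 0 := by linarith
  field_simp
  ring

theorem norm_qExp_term {a : ℝ} (ha : 1 < a) (z : ℂ) (n : ℕ) :
    ‖z ^ n / (qFactorial a n : ℂ)‖ = ‖z‖ ^ n / qFactorial a n := by
  rw [norm_div, norm_pow, Complex.norm_real, Real.norm_of_nonneg (qFactorial_pos ha n).le]

theorem summable_qExp {a : ℝ} (ha : 1 < a) (z : ℂ) :
    Summable fun n : ℕ => z ^ n / (qFactorial a n : ℂ) := by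
  refine Summable.of_norm ?_
  simp_rw [norm_qExp_term ha]
  exact summable_pow_div_qFactorial ha (norm_nonneg z)

theorem continuous_qExp {a : ℝ} (ha : 1 < a) : Continuous (qExp a) := by
  refine continuous_iff_continuousAt.mpr fun z => ?_
  have h : ContinuousOn (qExp a) (Metric.ball 0 (‖z‖ + 1)) := by
    refine continuousOn_tsum (u := fun n => (‖z‖ + 1) ^ n / qFactorial a n)
      (fun n => by fun_prop) (summable_pow_div_qFactorial ha (by positivity)) fun n w hw => ?_
    rw [norm_qExp_term ha]
    have hw : ‖w‖ < ‖z‖ + 1 := by simpa using hw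
    have := qFactorial_pos ha n
    gcongr
  exact h.continuousAt (Metric.isOpen_ball.mem_nhds (by simp))

theorem qExp_zero (a : ℝ) : qExp a 0 = 1 := by
  unfold qExp
  rw [tsum_eq_single 0 fun n hn => by rw [zero_pow hn, zero_div]]
  simp [qFactorial]

/-- Compare coefficients: `(a^(n+1) - 1) / [n+1]_a! = (a - 1) / [n]_a!`. This drives both the
location of the zeros and the decay in the outer integral. -/
theorem qExp_mul_left {a : ℝ} (ha : 1 < a) (z : ℂ) :
    qExp a (a * z) = (1 + (a - 1) * z) * qExp a z := by
  have hs := summable_qExp ha z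
  have hs' := summable_qExp ha (a * z)
  have e1 : qExp a (a * z) = 1 + ∑' n : ℕ, ((a : ℂ) * z) ^ (n + 1) / (qFactorial a (n + 1) : ℂ) := by
    unfold qExp
    rw [hs'.tsum_eq_zero_add]
    simp [qFactorial]
  have e2 : qExp a z = 1 + ∑' n : ℕ, z ^ (n + 1) / (qFactorial a (n + 1) : ℂ) := by
    unfold qExp
    rw [hs.tsum_eq_zero_add]
    simp [qFactorial]
  have hs1 := (summable_nat_add_iff 1).mpr hs
  have e3 : ∑' n : ℕ, ((a : ℂ) * z) ^ (n + 1) / (qFactorial a (n + 1) : ℂ)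
      = (∑' n : ℕ, z ^ (n + 1) / (qFactorial a (n + 1) : ℂ)) + (a - 1) * z * qExp a z := by
    unfold qExp
    rw [← tsum_mul_left, ← hs1.tsum_add (hs.mul_left _)]
    refine tsum_congr fun n => ?_
    have hF : (qFactorial a n : ℂ) ≠ 0 := by exact_mod_cast (qFactorial_pos ha n).ne'
    have h2 : (a : ℂ) ^ (n + 1) - 1 ≠ 0 := by
      have := one_lt_pow₀ ha (Nat.succ_ne_zero n)
      exact_mod_cast (sub_pos.mpr this).ne'
    have h3 : (a : ℂ) - 1 ≠ 0 := by exact_mod_cast (sub_pos.mpr ha).ne'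
    rw [qFactorial_succ]
    push_cast
    field_simp
    ring
  rw [e1, e3]
  linear_combination -e2

theorem one_add_mul_ne_zero_of_mem_slitPlane {c : ℝ} (hc : 0 ≤ c) {z : ℂ}
    (hz : z ∈ Complex.slitPlane) : 1 + (c : ℂ) * z ≠ 0 := by
  intro h
  have hre : 1 + c * z.re = 0 := by simpa using congrArg Complex.re h
  have him : c = 0 ∨ z.im = 0 := by simpa using congrArg Complex.im h
  rcases him with rfl | him
  · simp at hre
  · rcases Complex.mem_slitPlane_iff.mp hz with h' | h'
    · nlinarith
    · exact h' him

theorem ofReal_mul_mem_slitPlane {c : ℝ} (hc : 0 < c) {z : ℂ} (hz : z ∈ Complex.slitPlane) :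
    (c : ℂ) * z ∈ Complex.slitPlane := by
  rw [Complex.mem_slitPlane_iff] at hz ⊢
  rcases hz with h | h
  · left; simpa using mul_pos hc h
  · right; simpa using ⟨hc.ne', h⟩

/-- The zeros of the `q`-exponential lie on the negative real axis. -/
theorem qExp_ne_zero {a : ℝ} (ha : 1 < a) {z : ℂ} (hz : z ∈ Complex.slitPlane) :
    qExp a z ≠ 0 := by
  intro h0
  have ha0 : 0 < a := by linarith
  have hac : (a : ℂ) ≠ 0 := by exact_mod_cast ha0.ne'
  -- A zero at `z` propagates to every `a⁻ⁿ z`, because the linear factor in the functional equation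
  -- does not vanish on the slit plane. These points tend to `0`, where the value is `1`.
  have hall : ∀ n : ℕ, qExp a (((a⁻¹ ^ n : ℝ) : ℂ) * z) = 0 := by
    intro n
    induction n with
    | zero => simpa using h0
    | succ n ih =>
      have e : ((a⁻¹ ^ n : ℝ) : ℂ) * z = a * (((a⁻¹ ^ (n + 1) : ℝ) : ℂ) * z) := by
        push_cast
        rw [pow_succ]
        field_simp
      rw [e, qExp_mul_left ha, mul_eq_zero] at ih
      refine ih.resolve_left ?_
      have := one_add_mul_ne_zero_of_mem_slitPlane (c := a - 1) (by linarith)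
        (ofReal_mul_mem_slitPlane (pow_pos (inv_pos.mpr ha0) (n + 1)) hz)
      push_cast at this ⊢
      exact this
  have hlim : Tendsto (fun n : ℕ => ((a⁻¹ ^ n : ℝ) : ℂ) * z) atTop (𝓝 0) := by
    have h := tendsto_pow_atTop_nhds_zero_of_lt_one (inv_pos.mpr ha0).le (inv_lt_one_of_one_lt₀ ha)
    have := ((Complex.continuous_ofReal.tendsto 0).comp h).mul_const z
    simpa using this
  have h1 := ((continuous_qExp ha).tendsto 0).comp hlim
  rw [qExp_zero] at h1
  have h2 : Tendsto (fun _ : ℕ => (0 : ℂ)) atTop (𝓝 1) := h1.congr fun n => hall n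
  exact one_ne_zero (tendsto_nhds_unique h2 tendsto_const_nhds)

theorem ofReal_norm_qExp {a : ℝ} (ha : 1 < a) {x : ℝ} (hx : 0 ≤ x) :
    ENNReal.ofReal ‖qExp a x‖ = ∑' n : ℕ, ENNReal.ofReal (x ^ n / qFactorial a n) := by
  have hn : ∀ n : ℕ, 0 ≤ x ^ n / qFactorial a n := fun n =>
    div_nonneg (pow_nonneg hx n) (qFactorial_pos ha n).le
  have e : qExp a x = ((∑' n : ℕ, x ^ n / qFactorial a n : ℝ) : ℂ) := by
    unfold qExp
    push_cast
    rfl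
  rw [e, Complex.norm_real, Real.norm_of_nonneg (tsum_nonneg hn),
    ENNReal.ofReal_tsum_of_nonneg hn (summable_pow_div_qFactorial ha hx)]

/-! ### Integration and dilations on the half-line. -/

/-- A continuous function whose values decrease geometrically, faster than `a⁻¹`, along the
dilations by `a > 1` is integrable at infinity. -/
theorem integrableOn_Ioi_of_dilation_le {h : ℝ → ℝ} {a ρ T : ℝ} (ha : 1 < a) (hρ : ρ < 1)
    (hT : 0 < T) (hc : ContinuousOn h (Ioi 0)) (h0 : ∀ s, 0 < s → 0 ≤ h s)
    (hle : ∀ s, T ≤ s → a * h (a * s) ≤ ρ * h s) : IntegrableOn h (Ioi T) := by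
  have ha0 : 0 < a := by linarith
  have hint : ∀ x y, T ≤ x → x ≤ y → IntervalIntegrable h volume x y := fun x y hx hxy =>
    (hc.mono fun t ht => by
      rw [uIcc_of_le hxy] at ht
      exact lt_of_lt_of_le (hT.trans_le hx) ht.1).intervalIntegrable
  have hTb : ∀ n : ℕ, T ≤ T * a ^ n := fun n =>
    le_mul_of_one_le_right hT.le (one_le_pow₀ ha.le)
  have hlim : Tendsto (fun n : ℕ => T * a ^ n) atTop atTop :=
    (tendsto_pow_atTop_atTop_of_one_lt ha).const_mul_atTop hT
  set C := ∫ x in T..a * T, h x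
  have hTa : T ≤ a * T := le_mul_of_one_le_left hT.le ha.le
  have hρ' : 0 < 1 - ρ := by linarith
  -- With `I(y)` the integral from `T` to `y`, the dilation gives `I(y) ≤ I(a y) ≤ C + ρ I(y)`;
  -- solve for `I(y)`.
  have bound : ∀ y, T ≤ y → ∫ x in T..y, h x ≤ C / (1 - ρ) := by
    intro y hy
    have hay : a * T ≤ a * y := by gcongr
    have hyay : y ≤ a * y := le_mul_of_one_le_left (by linarith) ha.le
    have h1 : ∫ x in T..a * y, h x = C + a * ∫ x in T..y, h (a * x) := by
      rw [intervalIntegral.mul_integral_comp_mul_left,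
        intervalIntegral.integral_add_adjacent_intervals (hint _ _ le_rfl hTa) (hint _ _ hTa hay)]
    have hci : IntervalIntegrable (fun x => h (a * x)) volume T y := by
      refine ContinuousOn.intervalIntegrable ?_
      refine hc.comp (by fun_prop) fun t ht => ?_
      rw [uIcc_of_le hy] at ht
      exact mul_pos ha0 (hT.trans_le ht.1)
    have h2 : a * ∫ x in T..y, h (a * x) ≤ ρ * ∫ x in T..y, h x := by
      rw [← intervalIntegral.integral_const_mul, ← intervalIntegral.integral_const_mul]
      exact intervalIntegral.integral_mono_on hy (hci.const_mul a)
        ((hint _ _ le_rfl hy).const_mul ρ) fun x hx => hle x hx.1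
    have h3 : ∫ x in T..y, h x ≤ ∫ x in T..a * y, h x := by
      rw [← intervalIntegral.integral_add_adjacent_intervals (hint T y le_rfl hy)
        (hint y (a * y) hy hyay)]
      have : 0 ≤ ∫ x in y..a * y, h x := intervalIntegral.integral_nonneg hyay fun x hx =>
        h0 x (by linarith [hx.1])
      linarith
    rw [le_div_iff₀ hρ']
    linarith
  refine integrableOn_Ioi_of_intervalIntegral_norm_bounded (C / (1 - ρ)) T
    (fun n => ?_) hlim (Eventually.of_forall fun n => ?_)
  · exact (intervalIntegrable_iff_integrableOn_Ioc_of_le (hTb n)).mp (hint _ _ le_rfl (hTb n))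
  · have e : ∫ x in T..T * a ^ n, ‖h x‖ = ∫ x in T..T * a ^ n, h x := by
      refine intervalIntegral.integral_congr fun x hx => ?_
      rw [uIcc_of_le (hTb n)] at hx
      exact Real.norm_of_nonneg (h0 x (by linarith [hx.1]))
    rw [e]
    exact bound _ (hTb n)

theorem lintegral_Ioi_comp_mul_left (g : ℝ → ℝ≥0∞) {b : ℝ} (hb : 0 < b) :
    ∫⁻ x in Ioi (0 : ℝ), g x = ENNReal.ofReal b * ∫⁻ x in Ioi (0 : ℝ), g (b * x) := by
  have himg : (fun x => b * x) '' Ioi (0 : ℝ) = Ioi 0 := by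
    rw [image_mul_left_Ioi hb, mul_zero]
  have h := lintegral_image_eq_lintegral_abs_deriv_mul (s := Ioi (0 : ℝ)) (f := fun x => b * x)
    (f' := fun _ => b) measurableSet_Ioi
    (fun x _ => by simpa using ((hasDerivAt_id x).const_mul b).hasDerivWithinAt)
    (fun x _ y _ hxy => mul_left_cancel₀ hb.ne' hxy) g
  rw [himg, abs_of_pos hb] at h
  rw [h, lintegral_const_mul' _ _ ENNReal.ofReal_ne_top]

/-! ### The Theta function on the positive axis and its moments. -/

theorem jacobiThetaQ_term_succ {q : ℝ} (hq : 0 < q) {x : ℝ} (hx : 0 < x) (n : ℤ) :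
    x ^ (n + 1) / q ^ ((n + 1) * (n + 1 - 1) / 2) = x ^ n / q ^ (n * (n - 1) / 2) * (x / q ^ n) := by
  have e : (n + 1) * (n + 1 - 1) / 2 = n * (n - 1) / 2 + n := by
    rw [← Int.add_mul_ediv_right _ _ two_ne_zero]
    congr 1
    ring
  rw [e, zpow_add₀ hq.ne', zpow_add_one₀ hx.ne', mul_div_mul_comm]

theorem summable_jacobiThetaQ_real {q : ℝ} (hq : 1 < q) {x : ℝ} (hx : 0 < x) :
    Summable fun n : ℤ => x ^ n / q ^ (n * (n - 1) / 2) := by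
  have hq0 : 0 < q := by linarith
  have hpos : ∀ n : ℤ, 0 < x ^ n / q ^ (n * (n - 1) / 2) := fun n => by positivity
  have hlim := tendsto_pow_atTop_atTop_of_one_lt hq
  refine Summable.of_nat_of_neg_add_one ?_ ?_
  · refine summable_of_ratio_test_tendsto_lt_one zero_lt_one
      (Eventually.of_forall fun n => (hpos n).ne') ((hlim.const_div_atTop x).congr fun n => ?_)
    rw [Real.norm_of_nonneg (hpos _).le, Real.norm_of_nonneg (hpos _).le, Nat.cast_succ,
      jacobiThetaQ_term_succ hq0 hx, mul_div_cancel_left₀ _ (hpos n).ne', zpow_natCast]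
  · refine summable_of_ratio_test_tendsto_lt_one zero_lt_one
      (Eventually.of_forall fun n => (hpos _).ne')
      ((((tendsto_add_atTop_iff_nat 2).mpr hlim).const_div_atTop x⁻¹).congr fun n => ?_)
    rw [Real.norm_of_nonneg (hpos _).le, Real.norm_of_nonneg (hpos _).le, Nat.cast_succ]
    have h := jacobiThetaQ_term_succ hq0 hx (-((n : ℤ) + 1 + 1))
    have e : -((n : ℤ) + 1 + 1) + 1 = -((n : ℤ) + 1) := by ring
    have e' : q ^ (-((n : ℤ) + 1 + 1)) = (q ^ (n + 2))⁻¹ := by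
      rw [zpow_neg]
      norm_cast
    rw [e, e'] at h
    rw [h, div_mul_cancel_left₀ (hpos _).ne']
    field_simp

theorem norm_jacobiThetaQ_ofReal {q : ℝ} (hq : 0 < q) {x : ℝ} (hx : 0 < x) :
    ‖jacobiThetaQ q x‖ = ∑' n : ℤ, x ^ n / q ^ (n * (n - 1) / 2) := by
  have e : jacobiThetaQ q x = ((∑' n : ℤ, x ^ n / q ^ (n * (n - 1) / 2) : ℝ) : ℂ) := by
    unfold jacobiThetaQ
    push_cast
    rfl
  rw [e, Complex.norm_real, Real.norm_of_nonneg (tsum_nonneg fun n => by positivity)]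

/-- Shifting the summation index by one turns the series at `q x` into `q x` times the series at
`x`. -/
theorem norm_jacobiThetaQ_mul_left {q : ℝ} (hq : 1 < q) {x : ℝ} (hx : 0 < x) :
    ‖jacobiThetaQ q ((q * x : ℝ) : ℂ)‖ = q * x * ‖jacobiThetaQ q x‖ := by
  have hq0 : 0 < q := by linarith
  rw [norm_jacobiThetaQ_ofReal hq0 (by positivity), norm_jacobiThetaQ_ofReal hq0 hx,
    ← tsum_mul_left, ← (Equiv.addRight (1 : ℤ)).tsum_eq]
  refine tsum_congr fun n => ?_
  rw [Equiv.coe_addRight, jacobiThetaQ_term_succ hq0 (by positivity), mul_zpow]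
  have := zpow_pos hq0 n
  field_simp

/-- Only the terms of index `0` and `2` are kept; they suffice for the zeroth moment to be finite.
-/
theorem one_add_mul_sq_le_norm_jacobiThetaQ {q : ℝ} (hq : 1 < q) {x : ℝ} (hx : 0 < x) :
    1 + q * x ^ 2 ≤ ‖jacobiThetaQ q ((q * x : ℝ) : ℂ)‖ := by
  have hq0 : 0 < q := by linarith
  have hqx : 0 < q * x := by positivity
  rw [norm_jacobiThetaQ_ofReal hq0 hqx]
  have h := (summable_jacobiThetaQ_real hq hqx).sum_le_tsum {0, 2} fun n _ => by positivity
  refine le_trans (le_of_eq ?_) h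
  rw [Finset.sum_pair (by norm_num)]
  norm_num
  field_simp

/-- The moments of the inverse of the Theta function, up to a normalization. -/
theorem lintegral_pow_div_jacobiThetaQ_succ {q : ℝ} (hq : 1 < q) (n : ℕ) :
    ∫⁻ x in Ioi (0 : ℝ), ENNReal.ofReal (x ^ (n + 1) / ‖jacobiThetaQ q ((q * x : ℝ) : ℂ)‖)
      = ENNReal.ofReal (q ^ n) *
        ∫⁻ x in Ioi (0 : ℝ), ENNReal.ofReal (x ^ n / ‖jacobiThetaQ q ((q * x : ℝ) : ℂ)‖) := by
  have hq0 : 0 < q := by linarith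
  -- Substitute `q x` for `x`; the functional equation of Theta then lowers the power by one.
  rw [lintegral_Ioi_comp_mul_left _ hq0, ← lintegral_const_mul' _ _ ENNReal.ofReal_ne_top,
    ← lintegral_const_mul' _ _ ENNReal.ofReal_ne_top]
  refine setLIntegral_congr_fun measurableSet_Ioi fun x (hx : 0 < x) => ?_
  have hqx : 0 < q * x := by positivity
  have hΘ : 0 < ‖jacobiThetaQ q ((q * x : ℝ) : ℂ)‖ :=
    lt_of_lt_of_le (by positivity) (one_add_mul_sq_le_norm_jacobiThetaQ hq hx)
  rw [norm_jacobiThetaQ_mul_left hq hqx, ← ENNReal.ofReal_mul hq0.le,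
    ← ENNReal.ofReal_mul (by positivity)]
  congr 1
  field_simp
  ring

theorem lintegral_one_div_jacobiThetaQ_lt_top {q : ℝ} (hq : 1 < q) :
    ∫⁻ x in Ioi (0 : ℝ), ENNReal.ofReal (x ^ 0 / ‖jacobiThetaQ q ((q * x : ℝ) : ℂ)‖) < ⊤ := by
  have h := (integrable_inv_one_add_sq.integrableOn (s := Ioi (0 : ℝ))).lintegral_lt_top
  refine lt_of_le_of_lt (setLIntegral_mono' measurableSet_Ioi fun x (hx : 0 < x) => ?_) h
  rw [pow_zero, one_div]
  refine ENNReal.ofReal_le_ofReal (inv_anti₀ (by positivity) ?_)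
  refine le_trans ?_ (one_add_mul_sq_le_norm_jacobiThetaQ hq hx)
  nlinarith [sq_nonneg x]

/-- The quotient of factorials stands for `q^(n(n-1)/2)`: it satisfies the same recursion as the
moments. -/
theorem lintegral_pow_div_jacobiThetaQ {p q : ℝ} (hq : 1 < q) (hpq : q < p) (n : ℕ) :
    ∫⁻ x in Ioi (0 : ℝ), ENNReal.ofReal (x ^ n / ‖jacobiThetaQ q ((q * x : ℝ) : ℂ)‖)
      = ENNReal.ofReal (pqFactorial p q n / qFactorial (p / q) n) *
        ∫⁻ x in Ioi (0 : ℝ), ENNReal.ofReal (x ^ 0 / ‖jacobiThetaQ q ((q * x : ℝ) : ℂ)‖) := by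
  induction n with
  | zero => simp [pqFactorial, qFactorial]
  | succ n ih =>
    rw [lintegral_pow_div_jacobiThetaQ_succ hq, ih, pqFactorial_succ_div hq hpq,
      ENNReal.ofReal_mul (pow_nonneg (by linarith) n), mul_assoc]

theorem measurable_jacobiThetaQ {q : ℝ} : Measurable (jacobiThetaQ q) := by
  unfold jacobiThetaQ
  fun_prop

/-! ### The weight and the inner integral. -/

theorem summable_pow_div_pqFactorial {p q : ℝ} (hq : 1 < q) (hpq : q < p) {x : ℝ} (hx : 0 ≤ x) :
    Summable fun n : ℕ => x ^ n / pqFactorial p q n := by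
  have ha : 1 < p / q := (one_lt_div (by linarith)).mpr hpq
  refine Summable.of_nonneg_of_le
    (fun n => div_nonneg (pow_nonneg hx n) (pqFactorial_pos hq hpq n).le) (fun n => ?_)
    (summable_pow_div_qFactorial ha hx)
  exact div_le_div_of_nonneg_left (pow_nonneg hx n) (qFactorial_pos ha n)
    (qFactorial_le_pqFactorial hq hpq n)

theorem exp_weightOmega_le {M : ℕ → ℝ} (hM : ∀ n, 0 < M n) {x : ℝ} (hx : 0 < x)
    (hs : Summable fun n => x ^ n / M n) :
    Real.exp (weightOmega M x) ≤ ∑' n, x ^ n / M n := by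
  have hpos : ∀ n, 0 < x ^ n / M n := fun n => div_pos (pow_pos hx n) (hM n)
  rw [← Real.le_log_iff_exp_le (hs.tsum_pos (fun n => (hpos n).le) 0 (hpos 0)), weightOmega,
    if_neg hx.ne']
  exact ciSup_le fun n => Real.log_le_log (hpos n) (hs.le_tsum n fun m _ => (hpos m).le)

/-- The inner integral of the kernel against the weight is a constant multiple of the
`p/q`-exponential. -/
theorem exists_lintegral_weightOmega_div_jacobiThetaQ_le {p q k : ℝ} (hq : 1 < q) (hpq : q < p)
    (hk : 0 < k) :
    ∃ C : ℝ≥0∞, C < ⊤ ∧ ∀ s : ℝ, 0 < s →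
      ∫⁻ r in Ioi (0 : ℝ), ENNReal.ofReal (Real.exp (weightOmega (pqFactorial p q) (r / k)) *
          (1 / s / ‖jacobiThetaQ q ((q * (r / s) : ℝ) : ℂ)‖))
        ≤ C * ENNReal.ofReal ‖qExp (p / q) ((s / k : ℝ) : ℂ)‖ := by
  have ha : 1 < p / q := (one_lt_div (by linarith)).mpr hpq
  refine ⟨_, lintegral_one_div_jacobiThetaQ_lt_top hq, fun s hs => ?_⟩
  -- The substitution `r = s x` cancels `1 / s` and frees the Theta factor from `s`.
  rw [ofReal_norm_qExp ha (by positivity), lintegral_Ioi_comp_mul_left _ hs,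
    ← lintegral_const_mul' _ _ ENNReal.ofReal_ne_top]
  calc _ ≤ ∫⁻ x in Ioi (0 : ℝ), ∑' n : ℕ, ENNReal.ofReal ((s / k) ^ n / pqFactorial p q n) *
          ENNReal.ofReal (x ^ n / ‖jacobiThetaQ q ((q * x : ℝ) : ℂ)‖) := by
        refine setLIntegral_mono' measurableSet_Ioi fun x (hx : 0 < x) => ?_
        have hsum := summable_pow_div_pqFactorial hq hpq (x := s * x / k) (by positivity)
        have hΘ := norm_nonneg (jacobiThetaQ q ((q * x : ℝ) : ℂ))
        have hnn : ∀ n : ℕ, 0 ≤ (s * x / k) ^ n / pqFactorial p q n := fun n =>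
          div_nonneg (by positivity) (pqFactorial_pos hq hpq n).le
        rw [← ENNReal.ofReal_mul hs.le, mul_div_cancel_left₀ x hs.ne']
        calc _ ≤ ENNReal.ofReal ((∑' n, (s * x / k) ^ n / pqFactorial p q n) *
                  (1 / ‖jacobiThetaQ q ((q * x : ℝ) : ℂ)‖)) := by
              refine ENNReal.ofReal_le_ofReal ?_
              have h := exp_weightOmega_le (pqFactorial_pos hq hpq)
                (x := s * x / k) (by positivity) hsum
              calc _ = Real.exp (weightOmega (pqFactorial p q) (s * x / k)) *
                    (1 / ‖jacobiThetaQ q ((q * x : ℝ) : ℂ)‖) := by field_simp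
                _ ≤ _ := mul_le_mul_of_nonneg_right h (by positivity)
          _ = _ := by
              rw [ENNReal.ofReal_mul (tsum_nonneg hnn), ENNReal.ofReal_tsum_of_nonneg hnn hsum,
                ← ENNReal.tsum_mul_right]
              refine tsum_congr fun n => ?_
              have := pqFactorial_pos hq hpq n
              rw [← ENNReal.ofReal_mul (hnn n), ← ENNReal.ofReal_mul (by positivity)]
              congr 1
              ring
    _ = ∑' n : ℕ, ENNReal.ofReal ((s / k) ^ n / pqFactorial p q n) *
          ∫⁻ x in Ioi (0 : ℝ), ENNReal.ofReal (x ^ n / ‖jacobiThetaQ q ((q * x : ℝ) : ℂ)‖) := by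
        have hm := measurable_jacobiThetaQ (q := q)
        rw [lintegral_tsum fun n => by fun_prop]
        exact tsum_congr fun n => lintegral_const_mul' _ _ ENNReal.ofReal_ne_top
    _ = _ := by
        rw [← ENNReal.tsum_mul_left]
        refine tsum_congr fun n => ?_
        have h1 := pqFactorial_pos hq hpq n
        have h2 := qFactorial_pos ha n
        rw [lintegral_pow_div_jacobiThetaQ hq hpq, ← mul_assoc, mul_comm,
          ← ENNReal.ofReal_mul (by positivity)]
        congr 2
        field_simp

/-! ### The outer integral. -/

theorem integrableOn_qExp_div_qExp {a k : ℝ} (ha : 1 < a) (hk : 0 < k) {ζ : ℂ}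
    (hζ : ζ ∈ Complex.slitPlane) (hkζ : 1 < k * ‖ζ‖) :
    IntegrableOn (fun s : ℝ => ‖qExp a ((s / k : ℝ) : ℂ)‖ / ‖qExp a (a * (s * ζ))‖) (Ioi 0) := by
  have ha0 : 0 < a := by linarith
  have hne : ∀ s : ℝ, 0 ≤ s → qExp a (a * (s * ζ)) ≠ 0 := by
    intro s hs
    rcases hs.eq_or_lt with rfl | hs
    · simp [qExp_zero]
    · exact qExp_ne_zero ha (ofReal_mul_mem_slitPlane ha0 (ofReal_mul_mem_slitPlane hs hζ))
  have hE := continuous_qExp ha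
  have hc : ContinuousOn (fun s : ℝ => ‖qExp a ((s / k : ℝ) : ℂ)‖ / ‖qExp a (a * (s * ζ))‖)
      (Ici 0) :=
    ContinuousOn.div (by fun_prop) (by fun_prop) fun s hs => norm_ne_zero_iff.mpr (hne s hs)
  obtain ⟨ρ, hρ1, hρ2⟩ := exists_between ((div_lt_one (by linarith)).mpr hkζ)
  have hρ0 : 0 < ρ := lt_trans (by positivity) hρ1
  have hδ : 0 < ρ * ‖ζ‖ - 1 / k := by
    rw [div_lt_iff₀ (by linarith)] at hρ1
    rw [sub_pos, div_lt_iff₀ hk]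
    linarith
  have ha1 : 0 < a - 1 := by linarith
  -- Beyond this threshold `a (1 + (a - 1) s / k) ≤ ρ ((a - 1) a s ‖ζ‖ - 1)`; the exact numerator `a
  -- + ρ` is rounded up to `a + 1`.
  set T := (a + 1) / ((a - 1) * a * (ρ * ‖ζ‖ - 1 / k)) with hT
  have hT0 : 0 < T := by positivity
  have hle : ∀ s : ℝ, T ≤ s →
      a * (‖qExp a ((a * s / k : ℝ) : ℂ)‖ / ‖qExp a (a * ((a * s : ℝ) * ζ))‖)
        ≤ ρ * (‖qExp a ((s / k : ℝ) : ℂ)‖ / ‖qExp a (a * (s * ζ))‖) := by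
    intro s hs
    have hs0 : 0 < s := hT0.trans_le hs
    have e1 : ((a * s / k : ℝ) : ℂ) = a * ((s / k : ℝ) : ℂ) := by push_cast; ring
    have e2 : ((a * s : ℝ) : ℂ) * ζ = a * (s * ζ) := by push_cast; ring
    rw [e1, e2, qExp_mul_left ha, qExp_mul_left ha (a * (s * ζ)), norm_mul, norm_mul,
      mul_div_mul_comm, ← mul_assoc]
    refine mul_le_mul_of_nonneg_right ?_ (by positivity)
    have n1 : ‖1 + ((a : ℂ) - 1) * ((s / k : ℝ) : ℂ)‖ = 1 + (a - 1) * (s / k) := by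
      have : 1 + ((a : ℂ) - 1) * ((s / k : ℝ) : ℂ) = ((1 + (a - 1) * (s / k) : ℝ) : ℂ) := by
        push_cast; ring
      rw [this, Complex.norm_real, Real.norm_of_nonneg (by positivity)]
    have n2 : (a - 1) * a * s * ‖ζ‖ - 1 ≤ ‖1 + ((a : ℂ) - 1) * (a * (s * ζ))‖ := by
      have h := norm_sub_norm_le (((a : ℂ) - 1) * (a * (s * ζ))) (-1)
      have h1 : ‖((a : ℂ) - 1) * (a * (s * ζ))‖ = (a - 1) * a * s * ‖ζ‖ := by
        have : ((a : ℂ) - 1) * (a * (s * ζ)) = (((a - 1) * a * s : ℝ) : ℂ) * ζ := by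
          push_cast; ring
        rw [this, norm_mul, Complex.norm_real, Real.norm_of_nonneg (by positivity)]
      rw [h1, norm_neg, norm_one, sub_neg_eq_add, add_comm _ (1 : ℂ)] at h
      exact h
    have hs' : a + 1 ≤ s * ((a - 1) * a * (ρ * ‖ζ‖ - 1 / k)) := by
      rwa [hT, div_le_iff₀ (by positivity)] at hs
    have key : a * (1 + (a - 1) * (s / k)) ≤ ρ * ((a - 1) * a * s * ‖ζ‖ - 1) := by
      have : s / k = s * (1 / k) := by ring
      rw [this]
      nlinarith
    have hpos : 0 < ‖1 + ((a : ℂ) - 1) * (a * (s * ζ))‖ := by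
      refine lt_of_lt_of_le ?_ n2
      have : 0 < a * (1 + (a - 1) * (s / k)) := by positivity
      exact pos_of_mul_pos_right (this.trans_le key) hρ0.le
    rw [n1, ← mul_div_assoc, div_le_iff₀ hpos]
    exact key.trans (mul_le_mul_of_nonneg_left n2 hρ0.le)
  rw [← Ioc_union_Ioi_eq_Ioi hT0.le]
  refine IntegrableOn.union ?_ ?_
  · exact ((hc.mono Icc_subset_Ici_self).integrableOn_Icc).mono_set Ioc_subset_Icc_self
  · exact integrableOn_Ioi_of_dilation_le ha hρ2 hT0 (hc.mono Ioi_subset_Ici_self)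
      (fun s _ => by positivity) hle

/-! ### Rays and sectors on the logarithmic surface. -/

namespace LogSurface

theorem continuous_toComplex : Continuous toComplex := by
  unfold toComplex modulus arg
  fun_prop

theorem toComplex_ne_zero (z : LogSurface) : z.toComplex ≠ 0 :=
  mul_ne_zero (by exact_mod_cast z.2.ne') (Complex.exp_ne_zero _)

theorem norm_toComplex (z : LogSurface) : ‖z.toComplex‖ = z.modulus := by
  rw [toComplex, norm_mul, Complex.norm_exp_ofReal_mul_I, mul_one, Complex.norm_real,
    Real.norm_of_nonneg (show 0 ≤ z.modulus from le_of_lt z.2)]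

theorem ray_of_pos {t r : ℝ} (hr : 0 < r) : ray t r = ⟨(r, t), hr⟩ := dif_pos hr

theorem arg_ray (t r : ℝ) : (ray t r).arg = t := by
  unfold ray arg
  split_ifs <;> rfl

theorem toComplex_ray {t r : ℝ} (hr : 0 < r) :
    (ray t r).toComplex = r * Complex.exp (t * Complex.I) := by
  rw [ray_of_pos hr]
  rfl

theorem ray_eq_ofLog {t r : ℝ} (hr : 0 < r) :
    ray t r = ofLog ((Real.log r : ℂ) + t * Complex.I) := by
  rw [ray_of_pos hr, ofLog]
  simp [Real.exp_log hr]

theorem closure_sector_subset {θ β d α : ℝ} (h : |θ - d| + β / 2 < α / 2) :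
    closure (sector θ β) ⊆ sector d α := by
  have hcl : IsClosed {z : LogSurface | |z.arg - θ| ≤ β / 2} := by
    refine isClosed_le ?_ continuous_const
    unfold arg
    fun_prop
  have hsub : sector θ β ⊆ {z : LogSurface | |z.arg - θ| ≤ β / 2} := by
    intro z (hz : |z.arg - θ| < β / 2)
    exact hz.le
  refine (closure_minimal hsub hcl).trans fun z hz => ?_
  have hz : |z.arg - θ| ≤ β / 2 := hz
  have := abs_sub_le z.arg θ d
  show |z.arg - d| < α / 2
  linarith

/-- Every sector contains a direction that is not opposite to that of a given point. -/
theorem exists_direction_div_mem_slitPlane (d : ℝ) {α : ℝ} (hα : 0 < α) (z : LogSurface) :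
    ∃ θ : ℝ, |θ - d| < α / 2 ∧ Complex.exp (θ * Complex.I) / z.toComplex ∈ Complex.slitPlane := by
  have e : ∀ θ : ℝ, Complex.exp (θ * Complex.I) / z.toComplex
      = ((z.modulus⁻¹ : ℝ) : ℂ) * Complex.exp ((θ - z.arg : ℝ) * Complex.I) := by
    intro θ
    have : (z.modulus : ℂ) ≠ 0 := by exact_mod_cast z.2.ne'
    rw [toComplex, Complex.ofReal_sub, sub_mul, Complex.exp_sub]
    have := Complex.exp_ne_zero (z.arg * Complex.I)
    push_cast
    field_simp
  have hm : 0 < z.modulus⁻¹ := inv_pos.mpr z.2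
  have key : ∀ θ : ℝ, Real.sin (θ - z.arg) ≠ 0 →
      Complex.exp (θ * Complex.I) / z.toComplex ∈ Complex.slitPlane := by
    intro θ h
    rw [e]
    refine ofReal_mul_mem_slitPlane hm (Complex.mem_slitPlane_iff.mpr (Or.inr ?_))
    rwa [Complex.exp_ofReal_mul_I_im]
  by_cases h : Real.sin (d - z.arg) = 0
  -- If `d` is parallel or opposite to `z`, turn by an angle below both `α / 2` and `π`: the sine
  -- becomes nonzero.
  · have hε : 0 < min (α / 4) 1 := by positivity
    refine ⟨d + min (α / 4) 1, ?_, key _ ?_⟩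
    · rw [add_sub_cancel_left, abs_of_pos hε]
      linarith [min_le_left (α / 4) 1]
    · rw [show d + min (α / 4) 1 - z.arg = d - z.arg + min (α / 4) 1 by ring, Real.sin_add, h,
        zero_mul, zero_add]
      refine mul_ne_zero (fun hcos => ?_) (Real.sin_pos_of_pos_of_lt_pi hε ?_).ne'
      · have := Real.sin_sq_add_cos_sq (d - z.arg)
        rw [h, hcos] at this
        norm_num at this
      · linarith [min_le_right (α / 4) 1, Real.pi_gt_three]
  · exact ⟨d, by simpa using half_pos hα, key d h⟩

theorem HolomorphicOn.continuousOn_ray {f : LogSurface → ℂ} {d α θ : ℝ}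
    (hf : HolomorphicOn f (sector d α)) (hθ : |θ - d| < α / 2) :
    ContinuousOn (fun r => f (ray θ r)) (Ioi 0) := by
  have h : ContinuousOn (fun r : ℝ => f (ofLog ((Real.log r : ℂ) + θ * Complex.I))) (Ioi 0) := by
    refine hf.continuousOn.comp (f := fun r : ℝ => (Real.log r : ℂ) + θ * Complex.I) ?_ ?_
    · exact (Complex.continuous_ofReal.comp_continuousOn
        (Real.continuousOn_log.mono fun r (hr : 0 < r) => hr.ne')).add continuousOn_const
    · intro r _
      show |(ofLog _).arg - d| < α / 2
      simpa [ofLog, arg] using hθ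
  exact h.congr fun r hr => by simp only [ray_eq_ofLog hr]

end LogSurface

/-! ### The double integral for `φ = 0`. -/

theorem convIntegrand_zero_eq (p q : ℝ) (f : LogSurface → ℂ) (z : LogSurface) (θ : ℝ) {s r : ℝ}
    (hs : 0 < s) (hr : 0 < r) :
    convIntegrand p q f z θ 0 s r =
      (((p / q - 1) / (Real.log p - Real.log q) * (q / Real.log q) : ℝ) : ℂ) *
        (Complex.exp (θ * Complex.I) / z.toComplex /
          qExp (p / q) ((p / q : ℝ) * (s * (Complex.exp (θ * Complex.I) / z.toComplex)))) *
        (((1 / s : ℝ) : ℂ) / jacobiThetaQ q ((q * (r / s) : ℝ) : ℂ)) * f (LogSurface.ray θ r) := by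
  have hs' : (s : ℂ) ≠ 0 := by exact_mod_cast hs.ne'
  have hr' : (r : ℂ) ≠ 0 := by exact_mod_cast hr.ne'
  have e1 : (LogSurface.ray (θ + 0) s).toComplex / z.toComplex
      = s * (Complex.exp (θ * Complex.I) / z.toComplex) := by
    rw [LogSurface.toComplex_ray hs, add_zero, mul_div_assoc]
  have e2 : (LogSurface.ray θ r).toComplex / (LogSurface.ray (θ + 0) s).toComplex
      = ((r / s : ℝ) : ℂ) := by
    rw [LogSurface.toComplex_ray hs, LogSurface.toComplex_ray hr, add_zero,
      mul_div_mul_right _ _ (Complex.exp_ne_zero _), Complex.ofReal_div]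
  simp only [convIntegrand, kernelOneTilde, kernelTwoTilde, kernelOne, kernelTwo]
  rw [e1, e2]
  generalize Complex.exp (θ * Complex.I) / z.toComplex = ζ
  have e3 : (p : ℂ) * (s * ζ) / q = (p / q : ℝ) * (s * ζ) := by push_cast; ring
  have e4 : (q : ℂ) * ((r / s : ℝ) : ℂ) = ((q * (r / s) : ℝ) : ℂ) := by push_cast; ring
  rw [e3, e4]
  simp only [div_eq_mul_inv _ (qExp _ _), div_eq_mul_inv _ (jacobiThetaQ _ _)]
  generalize (qExp (p / q) ((p / q : ℝ) * (s * ζ)))⁻¹ = E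
  generalize (jacobiThetaQ q ((q * (r / s) : ℝ) : ℂ))⁻¹ = Θ
  generalize (p / q - 1) / (Real.log p - Real.log q) = A
  generalize q / Real.log q = B
  push_cast
  field_simp

theorem lintegral_convIntegrand_zero_lt_top {p q k : ℝ} (hq : 1 < q) (hpq : q < p) (hk : 0 < k)
    {f : LogSurface → ℂ} {θ c : ℝ} (hc : 0 < c)
    (hf : ∀ r : ℝ, 0 < r → ‖f (LogSurface.ray θ r)‖
      ≤ c * Real.exp (weightOmega (pqFactorial p q) (r / k)))
    {z : LogSurface} (hz : z.modulus < k)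
    (hζ : Complex.exp (θ * Complex.I) / z.toComplex ∈ Complex.slitPlane) :
    (∫⁻ s in Ioi (0 : ℝ), ∫⁻ r in Ioi (0 : ℝ), ‖convIntegrand p q f z θ 0 s r‖ₑ) < ⊤ := by
  have ha : 1 < p / q := (one_lt_div (by linarith)).mpr hpq
  have hz0 : 0 < z.modulus := z.2
  have hkζ : 1 < k * ‖Complex.exp (θ * Complex.I) / z.toComplex‖ := by
    rw [norm_div, Complex.norm_exp_ofReal_mul_I, LogSurface.norm_toComplex, mul_one_div,
      one_lt_div hz0]
    exact hz
  obtain ⟨C, hC, hCle⟩ := exists_lintegral_weightOmega_div_jacobiThetaQ_le hq hpq hk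
  have hint := (integrableOn_qExp_div_qExp ha hk hζ hkζ).lintegral_lt_top
  set ζ := Complex.exp (θ * Complex.I) / z.toComplex
  set A : ℝ := (p / q - 1) / (Real.log p - Real.log q) * (q / Real.log q)
  have hB : 0 ≤ ‖A‖ * ‖ζ‖ * c := by positivity
  have hfin : C * ENNReal.ofReal (‖A‖ * ‖ζ‖ * c) *
      ∫⁻ s in Ioi (0 : ℝ), ENNReal.ofReal
        (‖qExp (p / q) ((s / k : ℝ) : ℂ)‖ / ‖qExp (p / q) ((p / q : ℝ) * (s * ζ))‖) < ⊤ :=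
    ENNReal.mul_lt_top (ENNReal.mul_lt_top hC ENNReal.ofReal_lt_top) hint
  refine lt_of_le_of_lt ?_ hfin
  rw [← lintegral_const_mul' _ _ (ENNReal.mul_lt_top hC ENNReal.ofReal_lt_top).ne]
  refine setLIntegral_mono' measurableSet_Ioi fun s (hs : 0 < s) => ?_
  set E := qExp (p / q) ((p / q : ℝ) * (s * ζ))
  calc _ ≤ ∫⁻ r in Ioi (0 : ℝ), ENNReal.ofReal (‖A‖ * ‖ζ‖ * c / ‖E‖) *
          ENNReal.ofReal (Real.exp (weightOmega (pqFactorial p q) (r / k)) *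
            (1 / s / ‖jacobiThetaQ q ((q * (r / s) : ℝ) : ℂ)‖)) := by
        refine setLIntegral_mono' measurableSet_Ioi fun r (hr : 0 < r) => ?_
        rw [convIntegrand_zero_eq p q f z θ hs hr, ← ofReal_norm,
          ← ENNReal.ofReal_mul (by positivity)]
        refine ENNReal.ofReal_le_ofReal ?_
        rw [norm_mul, norm_mul, norm_mul, norm_div ζ, norm_div _ (jacobiThetaQ _ _),
          Complex.norm_real, Complex.norm_real,
          Real.norm_of_nonneg (by positivity : 0 ≤ 1 / s)]
        refine (mul_le_mul_of_nonneg_left (hf r hr) (by positivity)).trans (le_of_eq ?_)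
        ring
    _ = ENNReal.ofReal (‖A‖ * ‖ζ‖ * c / ‖E‖) *
          ∫⁻ r in Ioi (0 : ℝ),
            ENNReal.ofReal (Real.exp (weightOmega (pqFactorial p q) (r / k)) *
              (1 / s / ‖jacobiThetaQ q ((q * (r / s) : ℝ) : ℂ)‖)) :=
        lintegral_const_mul' _ _ ENNReal.ofReal_ne_top
    _ ≤ ENNReal.ofReal (‖A‖ * ‖ζ‖ * c / ‖E‖) *
          (C * ENNReal.ofReal ‖qExp (p / q) ((s / k : ℝ) : ℂ)‖) :=
        mul_le_mul_right (hCle s hs) _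
    _ = _ := by
        rw [mul_left_comm, ← ENNReal.ofReal_mul (by positivity), mul_assoc C,
          ← ENNReal.ofReal_mul hB]
        congr 2
        ring

theorem aestronglyMeasurable_convIntegrand_zero {p q : ℝ} (hq : 1 < q) (hpq : q < p)
    {f : LogSurface → ℂ} {θ : ℝ}
    (hf : ContinuousOn (fun r => f (LogSurface.ray θ r)) (Ioi 0)) (z : LogSurface) :
    AEStronglyMeasurable (fun x : ℝ × ℝ => convIntegrand p q f z θ 0 x.1 x.2)
      (volume.restrict (Ioi (0 : ℝ) ×ˢ Ioi (0 : ℝ))) := by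
  have ha : 1 < p / q := (one_lt_div (by linarith)).mpr hpq
  have hm : MeasurableSet (Ioi (0 : ℝ) ×ˢ Ioi (0 : ℝ)) := measurableSet_Ioi.prod measurableSet_Ioi
  have hE := (continuous_qExp ha).measurable
  have hΘ := measurable_jacobiThetaQ (q := q)
  have hf' : AEStronglyMeasurable (fun x : ℝ × ℝ => f (LogSurface.ray θ x.2))
      (volume.restrict (Ioi (0 : ℝ) ×ˢ Ioi (0 : ℝ))) :=
    (hf.comp (f := Prod.snd) continuousOn_snd fun x hx => hx.2).aestronglyMeasurable hm
  refine AEStronglyMeasurable.congr (AEStronglyMeasurable.mul (Measurable.aestronglyMeasurable ?_)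
    hf') ((ae_restrict_iff' hm).mpr (Eventually.of_forall fun x hx =>
      (convIntegrand_zero_eq p q f z θ hx.1 hx.2).symm))
  fun_prop

theorem mainTheorem7 (p q k : ℝ) (hq : 1 < q) (hpq : q < p) (hk : 1 < k)
    (d α : ℝ) (hα : 0 < α) (f : LogSurface → ℂ)
    (hf : MemGrowthClass (pqFactorial p q) k d α f)
    (z : LogSurface) (hz : z.modulus < min (p / q - 1) k) :
    ∃ U ∈ 𝓝 z, ∃ θ φ : ℝ, (∀ r : ℝ, 0 < r → LogSurface.ray θ r ∈ LogSurface.sector d α) ∧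
      ∀ z' ∈ U,
        IntegrableOn (fun x : ℝ × ℝ => convIntegrand p q f z' θ φ x.1 x.2)
          (Ioi (0 : ℝ) ×ˢ Ioi (0 : ℝ)) volume ∧
        (∫⁻ s in Ioi (0 : ℝ), ∫⁻ r in Ioi (0 : ℝ), ‖convIntegrand p q f z' θ φ s r‖ₑ) < ⊤ := by
  obtain ⟨θ, hθ, hζ⟩ := LogSurface.exists_direction_div_mem_slitPlane d hα z
  have hmod : Continuous LogSurface.modulus := by
    unfold LogSurface.modulus
    fun_prop
  have hdir : Continuous fun w : LogSurface => Complex.exp (θ * Complex.I) / w.toComplex :=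
    continuous_const.div LogSurface.continuous_toComplex LogSurface.toComplex_ne_zero
  have hU : {w : LogSurface | w.modulus < k} ∩
      {w | Complex.exp (θ * Complex.I) / w.toComplex ∈ Complex.slitPlane} ∈ 𝓝 z :=
    inter_mem ((isOpen_lt hmod continuous_const).mem_nhds (lt_of_lt_of_le hz (min_le_right _ _)))
      ((Complex.isOpen_slitPlane.preimage hdir).mem_nhds hζ)
  -- A sector about `θ` whose half-opening is half the angular distance from `θ` to the boundary, so
  -- its closure stays inside.
  obtain ⟨c, hc, hgrowth⟩ := hf.growth θ ((α / 2 - |θ - d|)) (by linarith)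
    (LogSurface.closure_sector_subset (by linarith))
  have hfr : ∀ r : ℝ, 0 < r → ‖f (LogSurface.ray θ r)‖
      ≤ c * Real.exp (weightOmega (pqFactorial p q) (r / k)) := by
    intro r hr
    have hmem : LogSurface.ray θ r ∈ LogSurface.sector θ (α / 2 - |θ - d|) := by
      show |(LogSurface.ray θ r).arg - θ| < _
      rw [LogSurface.arg_ray, sub_self, abs_zero]
      linarith
    have hr' : (LogSurface.ray θ r).modulus = r := by
      rw [LogSurface.ray_of_pos hr]
      rfl
    simpa only [hr'] using hgrowth _ hmem
  refine ⟨_, hU, θ, 0, fun r _ => ?_, fun z' hz' => ?_⟩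
  · show |(LogSurface.ray θ r).arg - d| < α / 2
    rwa [LogSurface.arg_ray]
  have hfin := lintegral_convIntegrand_zero_lt_top hq hpq (by linarith) hc hfr hz'.1 hz'.2
  have hmeas := aestronglyMeasurable_convIntegrand_zero hq hpq
    (hf.holomorphic.continuousOn_ray hθ) z'
  refine ⟨⟨hmeas, ?_⟩, hfin⟩
  -- Tonelli: the iterated bound gives integrability on the product.
  rw [Measure.volume_eq_prod, ← Measure.prod_restrict] at hmeas ⊢
  rw [HasFiniteIntegral, lintegral_prod _ hmeas.enorm]
  exact hfin
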